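/- Let $N\ge 1$ and $d\ge 2$ be integers. For $A\in\operatorname{SL}_N(\overline{\mathbb{Q}})$ and $\mathbf{b}\in\overline{\mathbb{Q}}^N$ let $f_{A,\mathbf{b}}:\mathbb{P}^N\to\mathbb{P}^N$ be the extension to $\mathbb{P}^N$ of the map $\mathbf{X}\mapsto A\mathbf{X}^d+\mathbf{b}$ of $\mathbb{A}^N$, where $\mathbf{X}^d=(X_1^d,\dots,X_N^d)$; that is, $f_{A,\mathbf{b}}([\mathbf{X}:Z])=[A\mathbf{X}^d+Z^d\mathbf{b}:Z^d]$. An endomorphism $f$ of $\mathbb{P}^N$ over $\overline{\mathbb{Q}}$ is called post-critically finite (PCF) if its post-critical locus $P_f=\bigcup_{n\ge 1}f^n(C_f)$ is a (proper) algebraic subset of $\mathbb{P}^N$, where $C_f$ is the critical locus, defined by the vanishing of the determinant of the Jacobian matrix of $f$. For a tuple $x$ of elements, not all zero, of a number field $F$ write \[h(x)=\sum_v\frac{[F_v:\mathbb{Q}_v]}{[F:\mathbb{Q}]}\log\max_i|x_i|_v\] (sum over all places $v$ of $F$) for the absolute logarithmic height of $x$, which does not depend on $F$; let $h(A)$ be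 the height of the tuple of entries of $A$, and let $h(\mathbf{b})$ be the height of $(b_1,\dots,b_N,1)$. For every $B\ge 0$ there is a constant $C$, depending only on $d$, $N$ and $B$, such that for all $A\in\operatorname{SL}_N(\overline{\mathbb{Q}})$ with $h(A)\le B$ and all $\mathbf{b}\in\overline{\mathbb{Q}}^N$: if $f_{A,\mathbf{b}}$ is PCF, then $h(\mathbf{b})\le C$. -/

import Mathlib

open scoped LinearAlgebra.Projectivization

noncomputable section

/-- The absolute logarithmic height of the tuple `x` of algebraic numbers, as homogeneous
coordinates: for `F = ℚ(x)` it is `∑_v ([F_v : ℚ_v] / [F : ℚ]) log max_i |x i|_v`,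
the sum being over all places `v` of `F` (the zero tuple gets height `0`). -/
def absLogHeight {ι : Type*} [Finite ι] (x : ι → AlgebraicClosure ℚ) : ℝ :=
  haveI : FiniteDimensional ℚ (IntermediateField.adjoin ℚ (Set.range x)) :=
    IntermediateField.finiteDimensional_adjoin fun y _ =>
      ((AlgebraicClosure.isAlgebraic ℚ).isAlgebraic y).isIntegral
  haveI : NumberField (IntermediateField.adjoin ℚ (Set.range x)) := {}
  Height.logHeight (K := IntermediateField.adjoin ℚ (Set.range x))
      (fun i => ⟨x i, IntermediateField.subset_adjoin ℚ _ (Set.mem_range_self i)⟩) /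
    (Module.finrank ℚ (IntermediateField.adjoin ℚ (Set.range x)) : ℝ)

/-- The height of a matrix: the height of its tuple of entries, as a point of projective space. -/
def matrixHeight {N : ℕ} (A : Matrix (Fin N) (Fin N) (AlgebraicClosure ℚ)) : ℝ :=
  absLogHeight fun p : Fin N × Fin N => A p.1 p.2

/-- The height of `b ∈ 𝔸^N`, i.e. of the point `[b₁ : ⋯ : b_N : 1] ∈ ℙ^N`. -/
def affineHeight {N : ℕ} (b : Fin N → AlgebraicClosure ℚ) : ℝ :=
  absLogHeight (Fin.snoc b 1 : Fin (N + 1) → AlgebraicClosure ℚ)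

/-- A degree-`d` endomorphism of the projective space with coordinates indexed by `σ` over an
algebraically closed field `K`, presented by forms of degree `d` with no common zero. -/
structure ProjEndo (K : Type*) [Field K] (σ : Type*) (d : ℕ) where
  form : σ → MvPolynomial σ K
  isHomogeneous : ∀ i, (form i).IsHomogeneous d
  eq_zero_of_eval : ∀ v : σ → K, (∀ i, MvPolynomial.eval v (form i) = 0) → v = 0

namespace ProjEndo

variable {K : Type*} [Field K] {σ : Type*} {d : ℕ}

/-- The action on homogeneous coordinate vectors. -/
def evalVec (f : ProjEndo K σ d) (v : σ → K) : σ → K :=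
  fun i => MvPolynomial.eval v (f.form i)

theorem evalVec_ne_zero (f : ProjEndo K σ d) {v : σ → K} (hv : v ≠ 0) : f.evalVec v ≠ 0 :=
  fun h => hv (f.eq_zero_of_eval v fun i => congrFun h i)

theorem evalVec_smul (f : ProjEndo K σ d) (t : K) (v : σ → K) :
    f.evalVec (t • v) = t ^ d • f.evalVec v := by
  funext i
  simp only [evalVec, Pi.smul_apply, smul_eq_mul]
  rw [MvPolynomial.eval_eq, MvPolynomial.eval_eq, Finset.mul_sum]
  refine Finset.sum_congr rfl fun m hm => ?_
  have hd : ∑ j ∈ m.support, m j = d := by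
    have := (f.isHomogeneous i) (MvPolynomial.mem_support_iff.mp hm)
    rwa [Finsupp.weight_apply, Finsupp.sum, Finset.sum_congr rfl (g := fun j => m j)
      (fun j _ => by simp)] at this
  simp only [Pi.smul_apply, smul_eq_mul, mul_pow, Finset.prod_mul_distrib,
    Finset.prod_pow_eq_pow_sum, hd]
  ring

/-- The self-map of (the closed points of) projective space. -/
def toFun (f : ProjEndo K σ d) : ℙ K (σ → K) → ℙ K (σ → K) :=
  Projectivization.lift
    (fun v => Projectivization.mk K (f.evalVec v.1) (f.evalVec_ne_zero v.2)) (by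
      intro v w t h
      refine (Projectivization.mk_eq_mk_iff' K _ _ _ _).2 ⟨t ^ d, ?_⟩
      rw [← f.evalVec_smul, ← h])

/-- The critical locus: the vanishing of the determinant of the Jacobian matrix. -/
def critLocus [Fintype σ] [DecidableEq σ] (f : ProjEndo K σ d) : Set (ℙ K (σ → K)) :=
  {P | MvPolynomial.eval P.rep
    (Matrix.det (Matrix.of fun i j => MvPolynomial.pderiv j (f.form i))) = 0}

/-- The post-critical locus `⋃_{n ≥ 1} fⁿ(C_f)`. -/
def postCritLocus [Fintype σ] [DecidableEq σ] (f : ProjEndo K σ d) : Set (ℙ K (σ → K)) :=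
  ⋃ n : ℕ, f.toFun^[n + 1] '' f.critLocus

end ProjEndo

/-- Zariski closed subsets of projective space: common zero loci of sets of forms. -/
def IsProjAlgebraic {K : Type*} [Field K] {σ : Type*} (S : Set (ℙ K (σ → K))) : Prop :=
  ∃ I : Set (MvPolynomial σ K), (∀ p ∈ I, ∃ n, p.IsHomogeneous n) ∧
    S = {P | ∀ p ∈ I, MvPolynomial.eval P.rep p = 0}

/-- `f` is post-critically finite: its post-critical locus is a (proper) algebraic subset.
Being a countable union of hypersurfaces, the locus is algebraic as a union of subvarieties iff
that union is finite, and the union is then a proper subset. Over a countable field, infinitely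
many hypersurfaces could conceivably exhaust the closed points, hence the second clause. -/
def ProjEndo.IsPCF {K : Type*} [Field K] {σ : Type*} [Fintype σ] [DecidableEq σ] {d : ℕ}
    (f : ProjEndo K σ d) : Prop :=
  IsProjAlgebraic f.postCritLocus ∧ f.postCritLocus ≠ Set.univ

/-- The extension to `ℙ^N` of the map `X ↦ A X^d + b` of `𝔸^N`, i.e.
`[X : Z] ↦ [A X^d + b Z^d : Z^d]`, with `Z` the last coordinate. -/
def powerAffineEndo {K : Type*} [Field K] {N d : ℕ} (hd : d ≠ 0)
    (A : Matrix.SpecialLinearGroup (Fin N) K) (b : Fin N → K) : ProjEndo K (Fin (N + 1)) d where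
  form := Fin.snoc
    (fun i : Fin N =>
      ∑ j : Fin N, MvPolynomial.C (A.1 i j) * MvPolynomial.X j.castSucc ^ d +
        MvPolynomial.C (b i) * MvPolynomial.X (Fin.last N) ^ d)
    (MvPolynomial.X (Fin.last N) ^ d)
  isHomogeneous := by
    have hX : ∀ (c : K) (j : Fin (N + 1)), (MvPolynomial.C c *
        (MvPolynomial.X j : MvPolynomial (Fin (N + 1)) K) ^ d).IsHomogeneous d := fun c j => by
      simpa using (MvPolynomial.isHomogeneous_C _ c).mul
        ((MvPolynomial.isHomogeneous_X K j).pow d)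
    intro i
    refine Fin.lastCases ?_ (fun i => ?_) i
    · simpa using (MvPolynomial.isHomogeneous_X K (Fin.last N)).pow d
    · rw [Fin.snoc_castSucc]
      exact (MvPolynomial.IsHomogeneous.sum _ _ _ fun j _ => hX _ _).add (hX _ _)
  eq_zero_of_eval := by
    intro v hv
    have hlast : v (Fin.last N) = 0 := by
      have := hv (Fin.last N)
      simpa [hd] using this
    have hA : A.1.mulVec (fun j => v j.castSucc ^ d) = 0 := by
      funext i
      have := hv i.castSucc
      simpa [hlast, hd, Matrix.mulVec, dotProduct] using this
    have h0 := Matrix.eq_zero_of_mulVec_eq_zero (by rw [A.2]; exact one_ne_zero) hA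
    funext i
    refine Fin.lastCases hlast (fun j => ?_) i
    simpa [hd] using congrFun h0 j

end

/-!
Write `f x = A x ^ d + b` on affine space. The critical locus contains every hyperplane `x i = 0`,
so if `f` is PCF then all the images `f ^ k (x i = 0)`, `k ≥ 1`, lie in one hypersurface `F = 0`.
Each of these images contains a hypersurface, hence a component of `F = 0`. A finite set `Z` with a
point on each component therefore meets all of them.

Fix a place and suppose that `‖b‖` exceeds a suitable power of `‖A‖`. Choose `i` such that the
`i`-th coordinate of `A⁻¹ b` is largest. On `x i = 0` this coordinate of `A⁻¹ (f x)` is that of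
`A⁻¹ b`, so `‖f x‖` is already large. From then on each application of `f` multiplies the norm by a
factor greater than `1`, and the images of `x i = 0` eventually avoid the finite set `Z`, a
contradiction. So `‖b‖` is bounded by a power of `‖A‖` at every place, up to a constant which is
`1` at the nonarchimedean ones, and multiplying over all places bounds the height of `b`.
-/

open MvPolynomial Matrix

section Substitution

variable {R σ τ : Type*}

theorem eval_bind₁ [CommSemiring R] (x : τ → R) (g : σ → MvPolynomial τ R)
    (p : MvPolynomial σ R) : eval x (bind₁ g p) = eval (fun i => eval x (g i)) p :=
  eval₂Hom_bind₁ (RingHom.id R) x g p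

/-- The substitution `X i ↦ c i * X i`, the action of the diagonal torus on polynomials. -/
noncomputable def scaleVars [CommSemiring R] (c : σ → R) :
    MvPolynomial σ R →ₐ[R] MvPolynomial σ R :=
  bind₁ fun i => C (c i) * X i

theorem eval_scaleVars [CommSemiring R] (c x : σ → R) (p : MvPolynomial σ R) :
    eval x (scaleVars c p) = eval (c * x) p := by
  simp [scaleVars, eval_bind₁, Pi.mul_def]

theorem scaleVars_one [CommSemiring R] (p : MvPolynomial σ R) : scaleVars 1 p = p := by
  simp [scaleVars, bind₁_X_left]

theorem scaleVars_scaleVars [CommSemiring R] (c e : σ → R) (p : MvPolynomial σ R) :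
    scaleVars c (scaleVars e p) = scaleVars (c * e) p := by
  simp only [scaleVars, bind₁_bind₁, map_mul, bind₁_C_right, bind₁_X_right, Pi.mul_apply]
  simp only [mul_left_comm, mul_assoc]

theorem coeff_scaleVars [CommSemiring R] (c : σ → R) (p : MvPolynomial σ R) (m : σ →₀ ℕ) :
    coeff m (scaleVars c p) = (m.prod fun i k => c i ^ k) * coeff m p := by
  classical
  induction p using induction_on' with
  | monomial u a =>
    have : scaleVars c (monomial u a) = monomial u ((u.prod fun i k => c i ^ k) * a) := by
      rw [scaleVars, bind₁_monomial, monomial_eq (a := _ * a)]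
      simp only [mul_pow, map_mul, Finsupp.prod, map_prod, map_pow, Finset.prod_mul_distrib]
      ring
    rw [this, coeff_monomial, coeff_monomial]
    split_ifs with h
    · rw [h]
    · simp
  | add p q hp hq => rw [map_add, coeff_add, coeff_add, hp, hq, mul_add]

theorem scaleVars_ne_zero [CommRing R] [IsDomain R] {c : σ → R} (hc : ∀ i, c i ≠ 0)
    {p : MvPolynomial σ R} (hp : p ≠ 0) : scaleVars c p ≠ 0 := by
  obtain ⟨m, hm⟩ := ne_zero_iff.1 hp
  refine ne_zero_iff.2 ⟨m, ?_⟩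
  rw [coeff_scaleVars]
  exact mul_ne_zero (Finset.prod_ne_zero_iff.2 fun i _ => pow_ne_zero _ (hc i)) hm

theorem exists_expand_eq_of_forall_dvd [CommSemiring R] {d : ℕ} {p : MvPolynomial σ R}
    (h : ∀ m, coeff m p ≠ 0 → ∀ i, d ∣ m i) : ∃ q, expand d q = p := by
  classical
  refine ⟨∑ m ∈ p.support, monomial (m.mapRange (· / d) (Nat.zero_div d)) (coeff m p), ?_⟩
  conv_rhs => rw [as_sum p]
  rw [map_sum]
  refine Finset.sum_congr rfl fun m hm => ?_
  rw [expand_monomial]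
  refine congrArg (monomial · (coeff m p)) (Finsupp.ext fun i => ?_)
  simpa using Nat.mul_div_cancel' (h m (mem_support_iff.1 hm) i)

end Substitution

section RootsOfUnityNorm

variable {R σ : Type*} [CommRing R] [IsDomain R] {d : ℕ}

/-- The product of the translates of `p` under the torus `μ_d ^ σ`: up to the substitution
`X ↦ X ^ d` it is the norm of `p` for the extension `R[X ^ d] ⊆ R[X]`. -/
noncomputable def rootsOfUnityNorm (d : ℕ) (p : MvPolynomial σ R) : MvPolynomial σ R :=
  ∏ᶠ ζ : σ → rootsOfUnity d R, scaleVars (fun i => ((ζ i : Rˣ) : R)) p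

theorem rootsOfUnityNorm_ne_zero {p : MvPolynomial σ R} (hp : p ≠ 0) :
    rootsOfUnityNorm d p ≠ 0 :=
  finprod_ne_zero fun ζ => scaleVars_ne_zero (fun i => (ζ i : Rˣ).ne_zero) hp

variable [Finite σ] [NeZero d]

theorem dvd_rootsOfUnityNorm (p : MvPolynomial σ R) : p ∣ rootsOfUnityNorm d p := by
  cases nonempty_fintype (σ → rootsOfUnity d R)
  rw [rootsOfUnityNorm, finprod_eq_prod_of_fintype]
  have hone : scaleVars (fun i => (((1 : σ → rootsOfUnity d R) i : Rˣ) : R)) p = p :=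
    scaleVars_one p
  conv_lhs => rw [← hone]
  exact Finset.dvd_prod_of_mem (fun ζ : σ → rootsOfUnity d R =>
    scaleVars (fun i => ((ζ i : Rˣ) : R)) p) (Finset.mem_univ 1)

theorem scaleVars_rootsOfUnityNorm (η : σ → rootsOfUnity d R) (p : MvPolynomial σ R) :
    scaleVars (fun i => ((η i : Rˣ) : R)) (rootsOfUnityNorm d p) = rootsOfUnityNorm d p := by
  rw [rootsOfUnityNorm, map_finprod _ (Set.toFinite _),
    ← finprod_comp_equiv (f := fun ζ : σ → rootsOfUnity d R => scaleVars _ p) (Equiv.mulLeft η)]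
  refine finprod_congr fun ζ => ?_
  rw [scaleVars_scaleVars]
  congr 2

theorem exists_expand_eq_rootsOfUnityNorm [HasEnoughRootsOfUnity R d] (p : MvPolynomial σ R) :
    ∃ q, expand d q = rootsOfUnityNorm d p := by
  classical
  cases nonempty_fintype σ
  refine exists_expand_eq_of_forall_dvd fun m hm i => ?_
  obtain ⟨z, hz⟩ := HasEnoughRootsOfUnity.exists_primitiveRoot R d
  have hinv := congrArg (coeff m)
    (scaleVars_rootsOfUnityNorm (Function.update 1 i hz.toRootsOfUnity) p)
  rw [coeff_scaleVars, mul_eq_right₀ hm, Finsupp.prod_fintype _ _ (fun _ => pow_zero _),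
    Finset.prod_eq_single i (fun j _ hj => by simp [Function.update_of_ne hj]) (by simp)] at hinv
  exact hz.dvd_of_pow_eq_one _ (by simpa using hinv)

theorem exists_pow_eq_of_eval_rootsOfUnityNorm_eq_zero {p : MvPolynomial σ R} {x : σ → R}
    (hx : eval x (rootsOfUnityNorm d p) = 0) : ∃ y : σ → R, y ^ d = x ^ d ∧ eval y p = 0 := by
  obtain ⟨ζ, hζ⟩ : ∃ ζ : σ → rootsOfUnity d R,
      eval x (scaleVars (fun i => ((ζ i : Rˣ) : R)) p) = 0 := by
    contrapose! hx
    rw [rootsOfUnityNorm, map_finprod _ (Set.toFinite _)]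
    exact finprod_ne_zero hx
  rw [eval_scaleVars] at hζ
  refine ⟨_, ?_, hζ⟩
  ext i
  have : ((ζ i : Rˣ) : R) ^ d = 1 := by
    rw [← Units.val_pow_eq_pow_val, (mem_rootsOfUnity d _).1 (ζ i).2, Units.val_one]
  simp [mul_pow, this]

end RootsOfUnityNorm

section PowerAffineMap

variable {R n : Type*} [CommRing R] [Fintype n]

/-- The substitution `X ↦ A X + b`. -/
noncomputable def affineSubst (A : Matrix n n R) (b : n → R) :
    MvPolynomial n R →ₐ[R] MvPolynomial n R :=
  bind₁ fun i => ∑ j, C (A i j) * X j + C (b i)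

theorem eval_affineSubst (A : Matrix n n R) (b x : n → R) (p : MvPolynomial n R) :
    eval x (affineSubst A b p) = eval (A *ᵥ x + b) p := by
  simp [affineSubst, eval_bind₁, Matrix.mulVec, dotProduct, Pi.add_def]

/-- The self-map `x ↦ A x ^ d + b` of affine space, with `x ^ d` the coordinatewise power. -/
def powerAffineMap (d : ℕ) (A : Matrix n n R) (b x : n → R) : n → R :=
  A *ᵥ x ^ d + b

end PowerAffineMap

section Hypersurface

variable {K σ : Type*} [Field K]

/-- The set `S` contains the zero set of a nonconstant polynomial. Over an algebraically closed
field the image of a hypersurface under a finite map is a hypersurface, and this is the part of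
that fact that is needed. -/
def ContainsHypersurface (S : Set (σ → K)) : Prop :=
  ∃ q : MvPolynomial σ K, q ≠ 0 ∧ ¬ IsUnit q ∧ {x | eval x q = 0} ⊆ S

namespace ContainsHypersurface

theorem setOf_apply_eq_zero (i : σ) : ContainsHypersurface {x : σ → K | x i = 0} :=
  ⟨X i, X_ne_zero i, X_prime.not_isUnit, fun x hx => by simpa using hx⟩

theorem exists_irreducible {S : Set (σ → K)} (hS : ContainsHypersurface S) :
    ∃ p : MvPolynomial σ K, Irreducible p ∧ {x | eval x p = 0} ⊆ S := by
  obtain ⟨q, hq0, hqu, hqS⟩ := hS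
  obtain ⟨p, hp, r, rfl⟩ := WfDvdMonoid.exists_irreducible_factor hqu hq0
  exact ⟨p, hp, fun x hx => hqS (by simp_all)⟩

theorem image_pow [Finite σ] [IsAlgClosed K] {S : Set (σ → K)} (hS : ContainsHypersurface S)
    (d : ℕ) [NeZero (d : K)] : ContainsHypersurface ((· ^ d) '' S) := by
  have : NeZero d := .of_neZero_natCast K
  obtain ⟨p, hp0, hpu, hpS⟩ := hS
  obtain ⟨q, hq⟩ := exists_expand_eq_rootsOfUnityNorm (d := d) p
  refine ⟨q, ?_, fun hqu => hpu ?_, fun y hy => ?_⟩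
  · rintro rfl
    exact rootsOfUnityNorm_ne_zero hp0 (hq.symm.trans (map_zero _))
  · exact isUnit_of_dvd_unit (dvd_rootsOfUnityNorm p) (hq ▸ hqu.map (expand d))
  · choose x hx using fun i => IsAlgClosed.exists_pow_nat_eq (y i) (NeZero.pos d)
    obtain rfl : x ^ d = y := _root_.funext hx
    obtain ⟨z, hzx, hz⟩ := exists_pow_eq_of_eval_rootsOfUnityNorm_eq_zero (d := d)
      (p := p) (x := x) (by rw [← hq, eval_expand]; exact hy)
    exact ⟨z, hpS hz, hzx⟩

variable {n : Type*} [Fintype n] [DecidableEq n] {S : Set (n → K)} {A : Matrix n n K}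

theorem image_affine [Infinite K] (hS : ContainsHypersurface S) (hA : IsUnit A.det) (b : n → K) :
    ContainsHypersurface ((A *ᵥ · + b) '' S) := by
  obtain ⟨p, hp0, hpu, hpS⟩ := hS
  have hinv (r : MvPolynomial n K) :
      affineSubst A b (affineSubst A⁻¹ (-(A⁻¹ *ᵥ b)) r) = r := by
    refine funext fun x => ?_
    rw [eval_affineSubst, eval_affineSubst, mulVec_add, mulVec_mulVec, nonsing_inv_mul A hA,
      one_mulVec, add_neg_cancel_right]
  refine ⟨affineSubst A⁻¹ (-(A⁻¹ *ᵥ b)) p, fun h => hp0 ?_, fun h => hpu ?_, fun y hy => ?_⟩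
  · rw [← hinv p, h, map_zero]
  · exact hinv p ▸ h.map (affineSubst A b)
  · refine ⟨_, hpS ((eval_affineSubst _ _ y p).symm.trans hy), ?_⟩
    simp only [mulVec_add, mulVec_neg, mulVec_mulVec, mul_nonsing_inv A hA, one_mulVec,
      neg_add_cancel_right]

theorem image_powerAffineMap [IsAlgClosed K] {d : ℕ} [NeZero (d : K)]
    (hS : ContainsHypersurface S) (hA : IsUnit A.det) (b : n → K) :
    ContainsHypersurface (powerAffineMap d A b '' S) := by
  have : Infinite K := IsAlgClosed.instInfinite
  have := (hS.image_pow d).image_affine hA b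
  rwa [Set.image_image] at this

theorem image_powerAffineMap_iterate [IsAlgClosed K] {d : ℕ} [NeZero (d : K)]
    (hS : ContainsHypersurface S) (hA : IsUnit A.det) (b : n → K) (k : ℕ) :
    ContainsHypersurface ((powerAffineMap d A b)^[k] '' S) := by
  induction k with
  | zero => simpa using hS
  | succ k ih =>
    rw [Function.iterate_succ', Set.image_comp]
    exact ih.image_powerAffineMap hA b

end ContainsHypersurface

variable [Finite σ] [IsAlgClosed K]

theorem exists_eval_eq_zero_of_not_isUnit {p : MvPolynomial σ K} (hp : ¬ IsUnit p) :
    ∃ x : σ → K, eval x p = 0 := by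
  by_contra! h
  have hempty : zeroLocus K (Ideal.span {p}) = ∅ := by
    rw [zeroLocus_span]
    exact Set.eq_empty_of_forall_notMem fun x hx =>
      h x (by simpa [coe_aeval_eq_eval] using hx)
  have hrad := vanishingIdeal_zeroLocus_eq_radical (K := K) (Ideal.span {p})
  rw [hempty, vanishingIdeal_empty, eq_comm, Ideal.radical_eq_top,
    Ideal.span_singleton_eq_top] at hrad
  exact hp hrad

theorem dvd_of_irreducible_of_zeros_subset {p F : MvPolynomial σ K} (hp : Irreducible p)
    (h : {x | eval x p = 0} ⊆ {x | eval x F = 0}) : p ∣ F := by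
  have hF : F ∈ vanishingIdeal K (zeroLocus K (Ideal.span {p})) := by
    rw [zeroLocus_span]
    intro x hx
    simpa [coe_aeval_eq_eval] using h (by simpa [coe_aeval_eq_eval] using hx)
  rw [vanishingIdeal_zeroLocus_eq_radical] at hF
  obtain ⟨k, hk⟩ := hF
  exact hp.prime.dvd_of_dvd_pow (Ideal.mem_span_singleton.1 hk)

theorem exists_finite_forall_inter_nonempty {F : MvPolynomial σ K} (hF : F ≠ 0) :
    ∃ Z : Set (σ → K), Z.Finite ∧ ∀ S : Set (σ → K), ContainsHypersurface S →
      S ⊆ {x | eval x F = 0} → (S ∩ Z).Nonempty := by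
  obtain ⟨s, hs, hsF⟩ := UniqueFactorizationMonoid.exists_prime_factors F hF
  -- One zero on each irreducible component of `F = 0`: `S` contains such a component.
  choose! z hz using fun p (hp : p ∈ s) => exists_eval_eq_zero_of_not_isUnit (hs p hp).not_isUnit
  refine ⟨z '' {p | p ∈ s}, s.finite_toSet.image z, fun S hS hSF => ?_⟩
  obtain ⟨q, hq, hqS⟩ := hS.exists_irreducible
  have hqF : q ∣ F := dvd_of_irreducible_of_zeros_subset hq (hqS.trans hSF)
  obtain ⟨p, hp, hqp⟩ := hq.prime.exists_mem_multiset_dvd (hqF.trans hsF.symm.dvd)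
  obtain ⟨r, hr⟩ := (hq.prime.associated_of_dvd (hs p hp) hqp).symm.dvd
  refine ⟨z p, hqS ?_, p, hp, rfl⟩
  rw [Set.mem_ofPred_eq, hr, map_mul, hz p hp, zero_mul]

end Hypersurface

section Dehomogenize

theorem eval_smul_of_isHomogeneous {R σ : Type*} [CommSemiring R] {p : MvPolynomial σ R} {m : ℕ}
    (hp : p.IsHomogeneous m) (t : R) (v : σ → R) : eval (t • v) p = t ^ m * eval v p := by
  rw [eval_eq, eval_eq, Finset.mul_sum]
  refine Finset.sum_congr rfl fun u hu => ?_
  have hdeg : ∑ j ∈ u.support, u j = m := by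
    simpa [Finsupp.weight_apply, Finsupp.sum] using hp (mem_support_iff.1 hu)
  simp only [Pi.smul_apply, smul_eq_mul, mul_pow, Finset.prod_mul_distrib,
    Finset.prod_pow_eq_pow_sum, hdeg]
  ring

variable {R : Type*} {N : ℕ}

/-- The substitution of `1` for the last variable, i.e. restriction to the affine chart. -/
noncomputable def dehomogenize [CommSemiring R] :
    MvPolynomial (Fin (N + 1)) R →ₐ[R] MvPolynomial (Fin N) R :=
  bind₁ (Fin.snoc X 1 : Fin (N + 1) → MvPolynomial (Fin N) R)

theorem eval_dehomogenize [CommSemiring R] (p : MvPolynomial (Fin (N + 1)) R) (y : Fin N → R) :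
    eval y (dehomogenize p) = eval (Fin.snoc y 1 : Fin (N + 1) → R) p := by
  rw [dehomogenize, eval_bind₁]
  congr 2
  ext i
  refine Fin.lastCases ?_ (fun i => ?_) i <;> simp

theorem dehomogenize_ne_zero {K : Type*} [Field K] [Infinite K] {m : ℕ}
    {p : MvPolynomial (Fin (N + 1)) K} (hp : p.IsHomogeneous m) (hp0 : p ≠ 0) :
    dehomogenize p ≠ 0 := by
  intro h
  refine mul_ne_zero hp0 (X_ne_zero (Fin.last N)) (MvPolynomial.funext fun v => ?_)
  rw [map_mul, eval_X, map_zero, mul_eq_zero, or_iff_not_imp_right]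
  intro hv
  have hsnoc : v = v (Fin.last N) •
      (Fin.snoc (fun i => (v (Fin.last N))⁻¹ * v i.castSucc) 1 : Fin (N + 1) → K) := by
    ext i
    refine Fin.lastCases ?_ (fun i => ?_) i <;> simp [hv]
  rw [hsnoc, eval_smul_of_isHomogeneous hp, ← eval_dehomogenize, h, map_zero, mul_zero]

end Dehomogenize

section AffineChart

variable {K : Type*} [Field K] {N d : ℕ}

/-- The point `[x : 1]` of `ℙ^N` with affine coordinates `x`. -/
def affinePoint (x : Fin N → K) : ℙ K (Fin (N + 1) → K) :=
  Projectivization.mk K (Fin.snoc x 1 : Fin (N + 1) → K) fun h => by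
    simpa using congrFun h (Fin.last N)

theorem exists_affinePoint_rep_eq_smul (x : Fin N → K) :
    ∃ t : K, t ≠ 0 ∧ (affinePoint x).rep = t • (Fin.snoc x 1 : Fin (N + 1) → K) := by
  obtain ⟨t, ht⟩ := Projectivization.exists_smul_eq_mk_rep K
    (Fin.snoc x 1 : Fin (N + 1) → K) fun h => by simpa using congrFun h (Fin.last N)
  exact ⟨t, t.ne_zero, ht.symm⟩

theorem eval_affinePoint_rep_eq_zero_iff {m : ℕ} {p : MvPolynomial (Fin (N + 1)) K}
    (hp : p.IsHomogeneous m) (x : Fin N → K) :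
    eval (affinePoint x).rep p = 0 ↔ eval x (dehomogenize p) = 0 := by
  obtain ⟨t, ht0, ht⟩ := exists_affinePoint_rep_eq_smul x
  rw [ht, eval_smul_of_isHomogeneous hp, ← eval_dehomogenize,
    mul_eq_zero_iff_left (pow_ne_zero m ht0)]

variable (A : SpecialLinearGroup (Fin N) K) (b : Fin N → K)

theorem powerAffineEndo_toFun_affinePoint (hd : d ≠ 0) (x : Fin N → K) :
    (powerAffineEndo hd A b).toFun (affinePoint x) =
      affinePoint (powerAffineMap d A.1 b x) := by
  have h : (powerAffineEndo hd A b).evalVec (Fin.snoc x 1) =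
      (Fin.snoc (powerAffineMap d A.1 b x) 1 : Fin (N + 1) → K) := by
    ext i
    refine Fin.lastCases ?_ (fun i => ?_) i
    · simp [ProjEndo.evalVec, powerAffineEndo]
    · simp [ProjEndo.evalVec, powerAffineEndo, powerAffineMap, mulVec, dotProduct]
  simp only [ProjEndo.toFun, affinePoint, Projectivization.lift_mk, h]

theorem powerAffineEndo_toFun_iterate_affinePoint (hd : d ≠ 0) (x : Fin N → K) (k : ℕ) :
    (powerAffineEndo hd A b).toFun^[k] (affinePoint x) =
      affinePoint ((powerAffineMap d A.1 b)^[k] x) :=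
  ((show Function.Semiconj affinePoint _ _ from
    fun y => (powerAffineEndo_toFun_affinePoint A b hd y).symm).iterate_right k x).symm

theorem affinePoint_mem_critLocus (hd : 2 ≤ d) {x : Fin N → K} {i : Fin N} (hx : x i = 0) :
    affinePoint x ∈ (powerAffineEndo (Nat.ne_zero_of_lt hd) A b).critLocus := by
  obtain ⟨t, -, ht⟩ := exists_affinePoint_rep_eq_smul x
  have hrep : (affinePoint x).rep i.castSucc = 0 := by simp [ht, hx]
  have hderiv (l : Fin (N + 1)) : eval (affinePoint x).rep
      (pderiv i.castSucc ((X l : MvPolynomial (Fin (N + 1)) K) ^ d)) = 0 := by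
    rw [pderiv_pow, pderiv_X]
    by_cases hl : l = i.castSucc
    · simp [hl, hrep, show d - 1 ≠ 0 by omega]
    · simp [hl]
  rw [ProjEndo.critLocus, Set.mem_ofPred_eq, RingHom.map_det]
  refine det_eq_zero_of_column_eq_zero i.castSucc fun j => ?_
  rw [RingHom.mapMatrix_apply, map_apply, of_apply]
  refine Fin.lastCases ?_ (fun j => ?_) j
  · simpa only [powerAffineEndo, Fin.snoc_last] using hderiv (Fin.last N)
  · simp only [powerAffineEndo, Fin.snoc_castSucc, map_add, map_sum, pderiv_C_mul, map_mul,
      hderiv, mul_zero, Finset.sum_const_zero, add_zero]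

variable {A b}

theorem ProjEndo.IsPCF.exists_ne_zero_forall_image_subset [Infinite K] (hd : 2 ≤ d)
    (h : (powerAffineEndo (Nat.ne_zero_of_lt hd) A b).IsPCF) :
    ∃ F : MvPolynomial (Fin N) K, F ≠ 0 ∧ ∀ (i : Fin N) (k : ℕ),
      (powerAffineMap d A.1 b)^[k + 1] '' {x | x i = 0} ⊆ {x | eval x F = 0} := by
  obtain ⟨⟨I, hI, hlocus⟩, hne⟩ := h
  obtain ⟨P, hP⟩ := (Set.ne_univ_iff_exists_notMem _).1 hne
  obtain ⟨p, hpI, hp⟩ : ∃ p ∈ I, eval P.rep p ≠ 0 := by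
    simpa [hlocus] using hP
  obtain ⟨m, hm⟩ := hI p hpI
  refine ⟨dehomogenize p, dehomogenize_ne_zero hm (by rintro rfl; simp at hp), fun i k => ?_⟩
  rintro _ ⟨x, hx, rfl⟩
  have hmem : affinePoint ((powerAffineMap d A.1 b)^[k + 1] x) ∈
      (powerAffineEndo (Nat.ne_zero_of_lt hd) A b).postCritLocus :=
    Set.mem_iUnion.2 ⟨k, _, affinePoint_mem_critLocus A b hd hx,
      powerAffineEndo_toFun_iterate_affinePoint A b _ x (k + 1)⟩
  rw [hlocus] at hmem
  exact (eval_affinePoint_rep_eq_zero_iff hm _).1 (hmem p hpI)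

theorem ProjEndo.IsPCF.exists_finite_forall_inter_nonempty [IsAlgClosed K] [NeZero (d : K)]
    (hd : 2 ≤ d) (h : (powerAffineEndo (Nat.ne_zero_of_lt hd) A b).IsPCF) :
    ∃ Z : Set (Fin N → K), Z.Finite ∧ ∀ (i : Fin N) (k : ℕ),
      ((powerAffineMap d A.1 b)^[k + 1] '' {x | x i = 0} ∩ Z).Nonempty := by
  have : Infinite K := IsAlgClosed.instInfinite
  obtain ⟨F, hF0, hF⟩ := h.exists_ne_zero_forall_image_subset hd
  obtain ⟨Z, hZ, hmeets⟩ := _root_.exists_finite_forall_inter_nonempty hF0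
  exact ⟨Z, hZ, fun i k => hmeets _ ((ContainsHypersurface.setOf_apply_eq_zero i)
    |>.image_powerAffineMap_iterate (by simp [A.2]) b (k + 1)) (hF i k)⟩

end AffineChart

section MaxAbs

variable {L ι : Type*} [Ring L]

/-- The maximum norm of the tuple `x` with respect to the absolute value `w` (`0` for the empty
tuple). -/
noncomputable def maxAbs (w : AbsoluteValue L ℝ) (x : ι → L) : ℝ :=
  ⨆ i, w (x i)

variable {w : AbsoluteValue L ℝ}

theorem maxAbs_nonneg (x : ι → L) : 0 ≤ maxAbs w x :=
  Real.iSup_nonneg fun i => w.nonneg (x i)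

theorem maxAbs_le {x : ι → L} {c : ℝ} (hc : 0 ≤ c) (hx : ∀ i, w (x i) ≤ c) : maxAbs w x ≤ c :=
  Real.iSup_le hx hc

variable [Finite ι]

theorem apply_le_maxAbs (x : ι → L) (i : ι) : w (x i) ≤ maxAbs w x :=
  Finite.le_ciSup (fun i => w (x i)) i

theorem exists_apply_eq_maxAbs [Nonempty ι] (x : ι → L) : ∃ i, w (x i) = maxAbs w x :=
  exists_eq_ciSup_of_finite

theorem maxAbs_pow_le [IsDomain L] [Nonempty ι] (x : ι → L) (d : ℕ) :
    maxAbs w x ^ d ≤ maxAbs w (x ^ d) := by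
  obtain ⟨i, hi⟩ := exists_apply_eq_maxAbs (w := w) x
  rw [← hi, ← map_pow]
  exact apply_le_maxAbs (x ^ d) i

end MaxAbs

section SumBound

variable {L : Type*} [CommRing L] {w : AbsoluteValue L ℝ} {m : ℕ} {κ : ℝ}

/-- Under the absolute value `w`, a sum of at most `m` terms is at most `κ` times the largest
term. This treats archimedean (`κ = m`) and nonarchimedean (`κ = 1`) absolute values uniformly. -/
def SumBound (w : AbsoluteValue L ℝ) (m : ℕ) (κ : ℝ) : Prop :=
  ∀ (s : Multiset L) (c : ℝ), s.card ≤ m → 0 ≤ c → (∀ x ∈ s, w x ≤ c) → w s.sum ≤ κ * c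

namespace SumBound

theorem natCast : SumBound w m m := fun s c hs hc hx => by
  have hsum : w s.sum ≤ (s.map w).sum :=
    Multiset.le_sum_of_subadditive w w.map_zero.le w.add_le s
  calc w s.sum ≤ (s.map w).sum := hsum
    _ ≤ s.card • c := by
      simpa using Multiset.sum_le_card_nsmul (s.map w) c (by simpa using hx)
    _ ≤ m * c := by rw [nsmul_eq_mul]; gcongr

theorem one_of_isNonarchimedean (hw : IsNonarchimedean w) : SumBound w m 1 :=
  fun s c _ hc hx => by
  rw [one_mul]
  induction s using Multiset.induction with
  | empty => simpa using hc
  | cons a s ih =>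
    rw [Multiset.sum_cons]
    simp only [Multiset.mem_cons, forall_eq_or_imp, Multiset.card_cons] at *
    exact (hw a s.sum).trans (max_le hx.1 (ih (by omega) hx.2))

variable (h : SumBound w m κ)
include h

theorem sum_le {ι : Type*} [Fintype ι] (hm : Fintype.card ι ≤ m) {x : ι → L} {c : ℝ}
    (hc : 0 ≤ c) (hx : ∀ i, w (x i) ≤ c) : w (∑ i, x i) ≤ κ * c :=
  h (Finset.univ.val.map x) c (by simpa using hm) hc (by simpa using hx)

theorem one_le [IsDomain L] (hm : 1 ≤ m) : 1 ≤ κ := by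
  simpa using h {1} 1 (by simpa using hm) zero_le_one (by simp)

theorem sub_le [IsDomain L] (hm : 2 ≤ m) (x y : L) : w (x - y) ≤ κ * max (w x) (w y) := by
  simpa [sub_eq_add_neg] using h {x, -y} (max (w x) (w y)) (by simpa using hm)
    (le_max_of_le_left (w.nonneg x)) (by simp)

theorem maxAbs_sub_le [IsDomain L] {ι : Type*} [Finite ι] (hm : 2 ≤ m) (x y : ι → L) :
    maxAbs w (x - y) ≤ κ * max (maxAbs w x) (maxAbs w y) := by
  have hκ : 0 ≤ κ := zero_le_one.trans (h.one_le (by omega))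
  refine maxAbs_le (mul_nonneg hκ (le_max_of_le_left (maxAbs_nonneg x))) fun i =>
    (h.sub_le hm (x i) (y i)).trans ?_
  gcongr <;> exact apply_le_maxAbs _ i

variable {n : Type*} [Fintype n] {A : Matrix n n L} {a : ℝ}

theorem maxAbs_mulVec_le (hm : Fintype.card n ≤ m) (hκ : 0 ≤ κ) (ha : 0 ≤ a)
    (hA : ∀ i j, w (A i j) ≤ a) (x : n → L) : maxAbs w (A *ᵥ x) ≤ κ * a * maxAbs w x := by
  have hax : 0 ≤ a * maxAbs w x := mul_nonneg ha (maxAbs_nonneg x)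
  rw [mul_assoc]
  refine maxAbs_le (mul_nonneg hκ hax) fun i => h.sum_le hm hax fun j => ?_
  rw [map_mul]
  exact mul_le_mul (hA i j) (apply_le_maxAbs x j) (w.nonneg _) ha

variable [DecidableEq n]

theorem det_le [IsDomain L] (hm : (Fintype.card n).factorial ≤ m) (ha : 0 ≤ a)
    (hA : ∀ i j, w (A i j) ≤ a) : w A.det ≤ κ * a ^ Fintype.card n := by
  rw [det_apply]
  refine h.sum_le (by simpa [Fintype.card_perm] using hm) (by positivity) fun σ => ?_
  have hsign : w ((Equiv.Perm.sign σ : ℤ) : L) = 1 := by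
    rcases Int.units_eq_one_or (Equiv.Perm.sign σ) with hσ | hσ <;> simp [hσ]
  rw [Units.smul_def, zsmul_eq_mul, map_mul, hsign, one_mul, map_prod]
  calc ∏ i, w (A (σ i) i) ≤ ∏ _i : n, a :=
        Finset.prod_le_prod (fun i _ => w.nonneg _) fun i _ => hA _ _
    _ = a ^ Fintype.card n := by simp

theorem adjugate_apply_le [IsDomain L] (hm : (Fintype.card n).factorial ≤ m) (ha : 1 ≤ a)
    (hA : ∀ i j, w (A i j) ≤ a) (i j : n) : w (A.adjugate i j) ≤ κ * a ^ Fintype.card n := by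
  rw [adjugate_apply]
  refine h.det_le hm (zero_le_one.trans ha) fun k l => ?_
  rw [updateRow_apply, Pi.single_apply]
  split_ifs
  · simpa using ha
  · simpa using zero_le_one.trans ha
  · exact hA k l

theorem one_le_mul_of_det_eq_one [IsDomain L] [Nonempty n]
    (hm : (Fintype.card n).factorial ≤ m) (hdet : A.det = 1) (ha : 0 ≤ a)
    (hA : ∀ i j, w (A i j) ≤ a) : 1 ≤ κ * a := by
  have hdet_le : 1 ≤ κ * a ^ Fintype.card n := by
    simpa [hdet] using h.det_le hm ha hA
  have hκ : 1 ≤ κ := h.one_le ((Nat.factorial_pos _).trans_le hm)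
  rcases le_total 1 a with ha1 | ha1
  · exact one_le_mul_of_one_le_of_one_le hκ ha1
  · exact hdet_le.trans (by gcongr; exact pow_le_of_le_one ha ha1 Fintype.card_ne_zero)

end SumBound

/-- The matrix `A` and its inverse distort the maximum norm by at most the factor `T`; the last
field is phrased for a difference because the ultrametric inequality has no additive constant. -/
structure DistortionBound {n : Type*} [Fintype n] (w : AbsoluteValue L ℝ) (A : Matrix n n L)
    (T : ℝ) : Prop where
  one_le : 1 ≤ T
  maxAbs_mulVec_le (x : n → L) : maxAbs w (A *ᵥ x) ≤ T * maxAbs w x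
  maxAbs_sub_le (x y : n → L) :
    maxAbs w (x - y) ≤ T * max (maxAbs w (A *ᵥ x)) (maxAbs w (A *ᵥ y))

theorem SumBound.distortionBound [IsDomain L] {n : Type*} [Fintype n] [DecidableEq n] [Nonempty n]
    (h : SumBound w (Fintype.card n + 1).factorial κ) {A : Matrix n n L} (hdet : A.det = 1)
    {a : ℝ} (ha : 0 ≤ a) (hA : ∀ i j, w (A i j) ≤ a) :
    DistortionBound w A (κ ^ 3 * (κ * a) ^ Fintype.card n) := by
  set N := Fintype.card n
  have hN1 : 1 ≤ N := Fintype.card_pos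
  have hm1 : 1 ≤ (N + 1).factorial := Nat.factorial_pos _
  have hm2 : 2 ≤ (N + 1).factorial := Nat.factorial_le (m := 2) (by omega)
  have hmN : N ≤ (N + 1).factorial := (Nat.le_succ N).trans (Nat.self_le_factorial _)
  have hmfac : N.factorial ≤ (N + 1).factorial := Nat.factorial_le (Nat.le_succ N)
  have hκ : 1 ≤ κ := h.one_le hm1
  have hκa : 1 ≤ κ * a := h.one_le_mul_of_det_eq_one hmfac hdet ha hA
  have hadj : ∀ i j, w (A.adjugate i j) ≤ κ * (κ * a) ^ N :=
    h.adjugate_apply_le hmfac hκa fun i j => (hA i j).trans (le_mul_of_one_le_left ha hκ)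
  refine ⟨one_le_mul_of_one_le_of_one_le (one_le_pow₀ hκ) (one_le_pow₀ hκa), fun x => ?_,
    fun x y => ?_⟩
  · have hT : κ * a ≤ κ ^ 3 * (κ * a) ^ N :=
      (le_self_pow₀ hκa (by omega)).trans (le_mul_of_one_le_left (by positivity) (one_le_pow₀ hκ))
    exact (h.maxAbs_mulVec_le hmN (by positivity) ha hA x).trans
      (mul_le_mul_of_nonneg_right hT (maxAbs_nonneg x))
  · have hinv : x - y = A.adjugate *ᵥ (A *ᵥ x - A *ᵥ y) := by
      rw [← mulVec_sub, mulVec_mulVec, adjugate_mul, hdet, one_smul, one_mulVec]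
    calc maxAbs w (x - y) ≤ κ * (κ * (κ * a) ^ N) * maxAbs w (A *ᵥ x - A *ᵥ y) := by
          rw [hinv]
          exact h.maxAbs_mulVec_le hmN (by positivity) (by positivity) hadj _
      _ ≤ κ * (κ * (κ * a) ^ N) * (κ * max (maxAbs w (A *ᵥ x)) (maxAbs w (A *ᵥ y))) := by
          gcongr
          exact h.maxAbs_sub_le hm2 _ _
      _ = κ ^ 3 * (κ * a) ^ N * max (maxAbs w (A *ᵥ x)) (maxAbs w (A *ᵥ y)) := by ring

end SumBound

section Escape

theorem pow_mul_le_iterate {α : Type*} {f : α → α} {g : α → ℝ} {l R : ℝ} (hl : 1 ≤ l)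
    (hR : 0 ≤ R) (hf : ∀ x, R ≤ g x → l * g x ≤ g (f x)) {x : α} (hx : R ≤ g x) (k : ℕ) :
    l ^ k * g x ≤ g (f^[k] x) := by
  induction k with
  | zero => simp
  | succ k ih =>
    have hRk : R ≤ g (f^[k] x) :=
      (hx.trans (le_mul_of_one_le_left (hR.trans hx) (one_le_pow₀ hl))).trans ih
    rw [Function.iterate_succ_apply']
    calc l ^ (k + 1) * g x = l * (l ^ k * g x) := by ring
      _ ≤ l * g (f^[k] x) := by gcongr
      _ ≤ g (f (f^[k] x)) := hf _ hRk

namespace DistortionBound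

variable {L n : Type*} [CommRing L] [IsDomain L] [Fintype n] [Nonempty n]
  {w : AbsoluteValue L ℝ} {A : Matrix n n L} {T : ℝ} (hT : DistortionBound w A T) {d : ℕ}
  {b : n → L}
include hT

omit [IsDomain L] in
theorem exists_forall_maxAbs_le_mul_maxAbs_powerAffineMap (hd : d ≠ 0)
    (hb : b ∈ Set.range (A *ᵥ ·)) :
    ∃ i, ∀ x : n → L, x i = 0 → maxAbs w b ≤ T ^ 2 * maxAbs w (powerAffineMap d A b x) := by
  have hT0 : 0 ≤ T := zero_le_one.trans hT.one_le
  obtain ⟨y, rfl⟩ := hb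
  -- On `x i = 0` the `i`-th coordinate of `A⁻¹ (A x ^ d + A y)` is `y i`, so take `y i` largest.
  obtain ⟨i, hi⟩ := exists_apply_eq_maxAbs (w := w) y
  refine ⟨i, fun x hx => ?_⟩
  calc maxAbs w (A *ᵥ y) ≤ T * maxAbs w y := hT.maxAbs_mulVec_le y
    _ = T * w ((x ^ d + y) i) := by simp [← hi, hx, hd]
    _ ≤ T * maxAbs w (x ^ d + y - 0) := by
      rw [sub_zero]
      gcongr
      exact apply_le_maxAbs (x ^ d + y) i
    _ ≤ T * (T * max (maxAbs w (A *ᵥ (x ^ d + y))) (maxAbs w (A *ᵥ (0 : n → L)))) := by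
      gcongr
      exact hT.maxAbs_sub_le (x ^ d + y) 0
    _ = T ^ 2 * maxAbs w (powerAffineMap d A (A *ᵥ y) x) := by
      have hzero : maxAbs w (A *ᵥ (0 : n → L)) = 0 := by simp [maxAbs]
      rw [hzero, max_eq_left (maxAbs_nonneg _), mulVec_add, powerAffineMap]
      ring

theorem maxAbs_pow_le_mul_max (hb : b ∈ Set.range (A *ᵥ ·)) (x : n → L) :
    maxAbs w x ^ d ≤ T * max (maxAbs w (powerAffineMap d A b x)) (maxAbs w b) := by
  obtain ⟨y, rfl⟩ := hb
  calc maxAbs w x ^ d ≤ maxAbs w (x ^ d + y - y) := by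
        rw [add_sub_cancel_right]
        exact maxAbs_pow_le x d
    _ ≤ _ := by
        rw [powerAffineMap, ← mulVec_add]
        exact hT.maxAbs_sub_le (x ^ d + y) y

theorem mul_maxAbs_le_maxAbs_powerAffineMap (hd : 2 ≤ d) (hb : b ∈ Set.range (A *ᵥ ·))
    (hbT : T ^ 5 < maxAbs w b) {x : n → L} (hx : maxAbs w b / T ^ 2 ≤ maxAbs w x) :
    maxAbs w b / T ^ 3 * maxAbs w x ≤ maxAbs w (powerAffineMap d A b x) := by
  have hT1 : 1 ≤ T := hT.one_le
  have hT0 : 0 < T := zero_lt_one.trans_le hT1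
  have hbx : maxAbs w b ≤ T ^ 2 * maxAbs w x := by rwa [div_le_iff₀' (by positivity)] at hx
  have hx3 : T ^ 3 < maxAbs w x := lt_of_mul_lt_mul_left
    ((by ring : T ^ 2 * T ^ 3 = T ^ 5) ▸ hbT.trans_le hbx) (by positivity)
  have hx1 : 1 ≤ maxAbs w x := (one_le_pow₀ hT1).trans hx3.le
  have hsq : maxAbs w x ^ 2 ≤ T * max (maxAbs w (powerAffineMap d A b x)) (maxAbs w b) :=
    (pow_le_pow_right₀ hx1 hd).trans (hT.maxAbs_pow_le_mul_max hb x)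
  have hlt : T * maxAbs w b < maxAbs w x ^ 2 := calc
    T * maxAbs w b ≤ T * (T ^ 2 * maxAbs w x) := by gcongr
    _ = T ^ 3 * maxAbs w x := by ring
    _ < maxAbs w x ^ 2 := by rw [sq]; gcongr
  have hmax : maxAbs w b < maxAbs w (powerAffineMap d A b x) := by
    by_contra! hle
    exact (hsq.trans_lt' hlt).ne (by rw [max_eq_right hle])
  rw [max_eq_left hmax.le] at hsq
  rw [div_mul_eq_mul_div, div_le_iff₀' (by positivity)]
  calc maxAbs w b * maxAbs w x ≤ T ^ 2 * maxAbs w x * maxAbs w x := by gcongr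
    _ = T ^ 2 * maxAbs w x ^ 2 := by ring
    _ ≤ T ^ 2 * (T * maxAbs w (powerAffineMap d A b x)) := by gcongr
    _ = T ^ 3 * maxAbs w (powerAffineMap d A b x) := by ring

theorem maxAbs_le_of_forall_inter_nonempty (hd : 2 ≤ d) (hb : b ∈ Set.range (A *ᵥ ·))
    {Z : Set (n → L)} (hZ : Z.Finite) (hmeets : ∀ (i : n) (k : ℕ),
      ((powerAffineMap d A b)^[k + 1] '' {x | x i = 0} ∩ Z).Nonempty) :
    maxAbs w b ≤ T ^ 5 := by
  by_contra! hbT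
  have hT1 : 1 ≤ T := hT.one_le
  have : 0 < T := zero_lt_one.trans_le hT1
  have hb0 : 0 < maxAbs w b := (by positivity : 0 < T ^ 5).trans hbT
  have hl : 1 < maxAbs w b / T ^ 3 := by
    rw [one_lt_div (by positivity)]
    exact (pow_le_pow_right₀ hT1 (by norm_num)).trans_lt hbT
  have hR : 0 < maxAbs w b / T ^ 2 := by positivity
  obtain ⟨i, hi⟩ := hT.exists_forall_maxAbs_le_mul_maxAbs_powerAffineMap (d := d) (by omega) hb
  obtain ⟨c, hc⟩ := (hZ.image (maxAbs w)).bddAbove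
  obtain ⟨k, hk⟩ := pow_unbounded_of_one_lt (c / (maxAbs w b / T ^ 2)) hl
  obtain ⟨_, ⟨x, hx, rfl⟩, hxZ⟩ := hmeets i k
  have hstart : maxAbs w b / T ^ 2 ≤ maxAbs w (powerAffineMap d A b x) := by
    rw [div_le_iff₀' (by positivity)]
    exact hi x hx
  rw [div_lt_iff₀ hR] at hk
  refine absurd (hc ⟨_, hxZ, rfl⟩) (not_le.2 (hk.trans_le ?_))
  calc (maxAbs w b / T ^ 3) ^ k * (maxAbs w b / T ^ 2)
      ≤ (maxAbs w b / T ^ 3) ^ k * maxAbs w (powerAffineMap d A b x) := by gcongr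
    _ ≤ maxAbs w ((powerAffineMap d A b)^[k + 1] x) :=
      pow_mul_le_iterate (f := powerAffineMap d A b) (g := maxAbs w) hl.le hR.le
        (fun _ => hT.mul_maxAbs_le_maxAbs_powerAffineMap hd hb hbT) hstart k

end DistortionBound

end Escape

section ExtendAbsoluteValue

open NumberField FinitePlace

theorem exists_isNonarchimedean_absoluteValue_extending {K L E : Type*} [Field K] [Field L]
    [Algebra K L] [Algebra.IsAlgebraic K L] [NontriviallyNormedField E] [IsUltrametricDist E]
    [CompleteSpace E] (φ : K →+* E) :
    ∃ w : AbsoluteValue L ℝ, IsNonarchimedean w ∧ ∀ x, w (algebraMap K L x) = ‖φ x‖ := by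
  let _ := ((algebraMap E (AlgebraicClosure E)).comp φ).toAlgebra
  let _ := spectralNorm.normedField E (AlgebraicClosure E)
  let g : L →ₐ[K] AlgebraicClosure E := IsAlgClosed.lift
  refine ⟨place g.toRingHom, fun x y => ?_, fun x => ?_⟩
  · simp only [place_apply, map_add]
    exact isNonarchimedean_spectralNorm (K := E) _ _
  · exact (congrArg norm (g.commutes x)).trans (spectralNorm_extends (φ x))

theorem exists_isNonarchimedean_absoluteValue_extending_finitePlace {K : Type*} [Field K]
    [NumberField K] (v : FinitePlace K) (L : Type*) [Field L] [Algebra K L]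
    [Algebra.IsAlgebraic K L] :
    ∃ w : AbsoluteValue L ℝ, IsNonarchimedean w ∧ ∀ x, w (algebraMap K L x) = v x := by
  let P := v.maximalIdeal
  obtain ⟨x, hxP, hx0⟩ := Submodule.exists_mem_ne_zero_of_ne_bot P.ne_bot
  let _ : NontriviallyNormedField (P.adicCompletion K) :=
    .ofNormNeOne ⟨embedding (K := K) P x, by simpa using hx0,
      ((norm_lt_one_iff_mem K P x).2 hxP).ne⟩
  obtain ⟨w, hw, hwv⟩ := exists_isNonarchimedean_absoluteValue_extending (L := L)
    (E := P.adicCompletion K) (embedding (K := K) P)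
  exact ⟨w, hw, fun x => (hwv x).trans (v.norm_embedding_eq x)⟩

end ExtendAbsoluteValue

section HeightComparison

open Height Height.AdmissibleAbsValues

variable {K ι ι' : Type*} [Field K] [AdmissibleAbsValues K] [Finite ι] [Finite ι']

theorem hasFiniteMulSupport_maxAbs {x : ι → K} (hx : x ≠ 0) :
    (fun v : nonarchAbsVal (K := K) => maxAbs v.1 x).HasFiniteMulSupport := by
  have : Nonempty {j // x j ≠ 0} := nonempty_subtype.2 (Function.ne_iff.1 hx)
  simp_rw [maxAbs, Finite.iSup_eq_iSup_subtype hx]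
  exact .iSup fun i => hasFiniteMulSupport i.2

theorem mulHeight_le_of_forall_maxAbs_le {x : ι → K} {y : ι' → K} (hx : x ≠ 0) (hy : y ≠ 0)
    {c : ℝ} (hc : 0 ≤ c) {m : ℕ}
    (harch : ∀ v ∈ archAbsVal (K := K), maxAbs v x ≤ c * maxAbs v y ^ m)
    (hnonarch : ∀ v ∈ nonarchAbsVal (K := K), maxAbs v x ≤ maxAbs v y ^ m) :
    mulHeight x ≤ c ^ totalWeight K * mulHeight y ^ m := by
  have hprod : (archAbsVal.map fun v : AbsoluteValue K ℝ => maxAbs v x).prod ≤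
      c ^ totalWeight K * (archAbsVal.map fun v : AbsoluteValue K ℝ => maxAbs v y).prod ^ m := by
    refine (Multiset.prod_map_le_prod_map₀ _ _ (fun v _ => maxAbs_nonneg x) harch).trans_eq ?_
    rw [Multiset.prod_map_mul, Multiset.prod_map_pow, Multiset.map_const', Multiset.prod_replicate,
      totalWeight]
  have hfinprod : (∏ᶠ v : nonarchAbsVal (K := K), maxAbs v.1 x) ≤
      (∏ᶠ v : nonarchAbsVal (K := K), maxAbs v.1 y) ^ m := by
    rw [finprod_pow (hasFiniteMulSupport_maxAbs hy)]
    exact finprod_le_finprod (hasFiniteMulSupport_maxAbs hx) (fun v => maxAbs_nonneg x)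
      ((hasFiniteMulSupport_maxAbs hy).fun_pow m) fun v => hnonarch v.1 v.2
  rw [mulHeight_eq hx, mulHeight_eq hy, mul_pow, ← mul_assoc]
  exact mul_le_mul hprod hfinprod (finprod_nonneg fun v => maxAbs_nonneg x)
    (mul_nonneg (pow_nonneg hc _) (pow_nonneg (Multiset.prod_map_nonneg fun v _ =>
      maxAbs_nonneg y) _))

end HeightComparison

section HeightExtension

open Height Module NumberField

theorem prod_infinitePlace_pow_mult {K M : Type*} [Field K] [NumberField K] [CommMonoid M]
    (G : (K → ℝ) → M) :
    ∏ v : InfinitePlace K, G v ^ v.mult = ∏ φ : K →+* ℂ, G fun x => ‖φ x‖ := by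
  classical
  refine Eq.trans (Finset.prod_congr rfl fun v _ => ?_)
    (Finset.prod_fiberwise' Finset.univ InfinitePlace.mk fun v : InfinitePlace K => G v)
  rw [Finset.prod_const, InfinitePlace.card_filter_mk_eq]

theorem card_ringHom_comp_algebraMap_eq {F K E : Type*} [Field F] [Field K] [Field E]
    [IsAlgClosed E] [Algebra F K] [FiniteDimensional F K] [Algebra.IsSeparable F K] (ψ : F →+* E) :
    Nat.card {φ : K →+* E // φ.comp (algebraMap F K) = ψ} = finrank F K := by
  let _ := ψ.toAlgebra
  rw [← AlgHom.card F K E, ← Nat.card_eq_fintype_card]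
  exact Nat.card_congr
    { toFun φ := { φ.1 with commutes' := DFunLike.congr_fun φ.2 }
      invFun φ := ⟨φ, φ.comp_algebraMap⟩ }

variable {F K : Type*} [Field F] [NumberField F] [Field K] [NumberField K] [Algebra F K]

theorem prod_embeddings_comp_algebraMap {M : Type*} [CommMonoid M] (G : (F →+* ℂ) → M) :
    ∏ φ : K →+* ℂ, G (φ.comp (algebraMap F K)) = (∏ ψ : F →+* ℂ, G ψ) ^ finrank F K := by
  classical
  rw [← Fintype.prod_fiberwise' (fun φ : K →+* ℂ => φ.comp (algebraMap F K)) G,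
    ← Finset.prod_pow]
  refine Finset.prod_congr rfl fun ψ _ => ?_
  rw [Finset.prod_const, Finset.card_univ, ← Nat.card_eq_fintype_card,
    card_ringHom_comp_algebraMap_eq]

variable {ι : Type*} [Finite ι]

theorem mulHeight_algebraMap_comp_of_integers {x : ι → 𝓞 F} (hx : x ≠ 0) :
    mulHeight (fun i => algebraMap F K (x i)) = mulHeight (fun i => (x i : F)) ^ finrank F K := by
  let y : ι → 𝓞 K := algebraMap (𝓞 F) (𝓞 K) ∘ x
  have hy : y ≠ 0 := fun h => hx <| funext fun i =>
    FaithfulSMul.algebraMap_injective (𝓞 F) (𝓞 K) <| by simpa [y] using congrFun h i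
  have hx' : (fun i => (x i : F)) ≠ 0 := fun h => hx <| funext fun i =>
    RingOfIntegers.ext (by simpa using congrFun h i)
  have hy' : (fun i => algebraMap F K (x i)) ≠ 0 := fun h => hx' <| funext fun i => by
    simpa using congrFun h i
  have hnorm : (Ideal.span (Set.range y)).absNorm =
      (Ideal.span (Set.range x)).absNorm ^ finrank F K := by
    rw [Set.range_comp, ← Ideal.map_span, Ideal.absNorm_algebraMap,
      IsFractionRing.finrank_eq (𝓞 F) F (𝓞 K) K]
  -- The finite part of the height is the inverse norm of the ideal generated by the coordinates.
  have hfinite : (∏ᶠ v : FinitePlace K, ⨆ i, v (algebraMap F K (x i))) =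
      (∏ᶠ v : FinitePlace F, ⨆ i, v (x i : F)) ^ finrank F K := by
    have hnorm_y := absNorm_mul_finprod_finitePlace_eq_one hy
    rw [hnorm, Nat.cast_pow] at hnorm_y
    rw [eq_inv_of_mul_eq_one_right (absNorm_mul_finprod_finitePlace_eq_one hx), inv_pow]
    exact eq_inv_of_mul_eq_one_right hnorm_y
  have hinfinite : ∏ v : InfinitePlace K, (⨆ i, v (algebraMap F K (x i))) ^ v.mult =
      (∏ v : InfinitePlace F, (⨆ i, v (x i : F)) ^ v.mult) ^ finrank F K := by
    rw [prod_infinitePlace_pow_mult fun f => ⨆ i, f (x i : F),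
      prod_infinitePlace_pow_mult fun f => ⨆ i, f (algebraMap F K (x i)),
      ← prod_embeddings_comp_algebraMap]
    rfl
  rw [NumberField.mulHeight_eq hy', NumberField.mulHeight_eq hx', hinfinite, hfinite, mul_pow]

theorem mulHeight_algebraMap_comp (x : ι → F) :
    mulHeight (algebraMap F K ∘ x) = mulHeight x ^ finrank F K := by
  obtain rfl | hx := eq_or_ne x 0
  · simp
  obtain ⟨c, hc⟩ := IsLocalization.exist_integer_multiples_of_finite (nonZeroDivisors (𝓞 F)) x
  choose y hy using hc
  have hc0 : ((c : 𝓞 F) : F) ≠ 0 := by simp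
  have hyx : (fun i => (y i : F)) = ((c : 𝓞 F) : F) • x := funext fun i =>
    (hy i).trans (Algebra.smul_def _ _)
  have hyx' : (fun i => algebraMap F K (y i)) =
      algebraMap F K ((c : 𝓞 F) : F) • (algebraMap F K ∘ x) := by
    ext i
    simpa using congrArg (algebraMap F K) (congrFun hyx i)
  have hy0 : y ≠ 0 := by
    rintro rfl
    exact smul_ne_zero hc0 hx (hyx.symm.trans (funext fun i => by simp))
  rw [← mulHeight_smul_eq_mulHeight x hc0, ← hyx, ← mulHeight_algebraMap_comp_of_integers hy0,
    hyx', mulHeight_smul_eq_mulHeight _ (by simp)]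

theorem logHeight_algebraMap_comp (x : ι → F) :
    logHeight (algebraMap F K ∘ x) = finrank F K * logHeight x := by
  rw [logHeight_eq_log_mulHeight, logHeight_eq_log_mulHeight, mulHeight_algebraMap_comp,
    Real.log_pow]

end HeightExtension

section AbsLogHeight

open Height Module

theorem numberField_adjoin_of_finite {S : Set (AlgebraicClosure ℚ)} (hS : S.Finite) :
    NumberField (IntermediateField.adjoin ℚ S) :=
  have := hS.to_subtype
  have : FiniteDimensional ℚ (IntermediateField.adjoin ℚ S) :=
    IntermediateField.finiteDimensional_adjoin fun y _ =>
      ((AlgebraicClosure.isAlgebraic ℚ).isAlgebraic y).isIntegral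
  {}

variable {ι : Type*} [Finite ι]

theorem absLogHeight_coe (K : IntermediateField ℚ (AlgebraicClosure ℚ)) [NumberField K]
    (y : ι → K) :
    absLogHeight (fun i => (y i : AlgebraicClosure ℚ)) = logHeight y / finrank ℚ K := by
  let x : ι → AlgebraicClosure ℚ := fun i => y i
  let F : IntermediateField ℚ (AlgebraicClosure ℚ) := IntermediateField.adjoin ℚ (Set.range x)
  have hle : F ≤ K :=
    IntermediateField.adjoin_le_iff.2 (Set.range_subset_iff.2 fun i => (y i).2)
  have : NumberField F := numberField_adjoin_of_finite (Set.finite_range x)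
  let _ : Algebra F K := (IntermediateField.inclusion hle).toRingHom.toAlgebra
  let x' : ι → F :=
    fun i => ⟨x i, IntermediateField.subset_adjoin ℚ _ (Set.mem_range_self i)⟩
  calc absLogHeight x = logHeight x' / finrank ℚ F := rfl
    _ = finrank F K * logHeight x' / (finrank F K * finrank ℚ F) := by
      rw [mul_div_mul_left _ _ (Nat.cast_ne_zero.2 finrank_pos.ne')]
    _ = logHeight y / finrank ℚ K := by
      rw [← logHeight_algebraMap_comp, ← finrank_mul_finrank ℚ F K, Nat.cast_mul, mul_comm]
      rfl

theorem absLogHeight_eq_zero_of_subsingleton [Subsingleton ι] (x : ι → AlgebraicClosure ℚ) :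
    absLogHeight x = 0 := by
  have : NumberField (IntermediateField.adjoin ℚ (Set.range x)) :=
    numberField_adjoin_of_finite (Set.finite_range x)
  rw [absLogHeight, logHeight_eq_zero_of_subsingleton, zero_div]

end AbsLogHeight

section LocalBound

variable {L : Type*} [Field L] [IsAlgClosed L] {N d : ℕ} [NeZero N] [NeZero (d : L)]
  {w : AbsoluteValue L ℝ} {κ : ℝ}

theorem ProjEndo.IsPCF.maxAbs_snoc_le (hκ : SumBound w (N + 1).factorial κ)
    (hd : 2 ≤ d) {A : SpecialLinearGroup (Fin N) L} {b : Fin N → L}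
    (h : (powerAffineEndo (Nat.ne_zero_of_lt hd) A b).IsPCF) :
    maxAbs w (Fin.snoc b 1 : Fin (N + 1) → L) ≤
      κ ^ (5 * (N + 3)) * maxAbs w (fun p : Fin N × Fin N => A.1 p.1 p.2) ^ (5 * N) := by
  obtain ⟨Z, hZ, hmeets⟩ := h.exists_finite_forall_inter_nonempty hd
  set a := maxAbs w fun p : Fin N × Fin N => A.1 p.1 p.2
  have hT : DistortionBound w A.1 (κ ^ 3 * (κ * a) ^ N) := by
    simpa using SumBound.distortionBound (n := Fin N) (by simpa using hκ) A.2
      (maxAbs_nonneg _) fun i j => apply_le_maxAbs (fun p : Fin N × Fin N => A.1 p.1 p.2) (i, j)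
  have hb : b ∈ Set.range (A.1 *ᵥ ·) := ⟨A.1.adjugate *ᵥ b, by simp [mul_adjugate]⟩
  have hT5 : (κ ^ 3 * (κ * a) ^ N) ^ 5 = κ ^ (5 * (N + 3)) * a ^ (5 * N) := by ring
  have hT5_one : 1 ≤ (κ ^ 3 * (κ * a) ^ N) ^ 5 := one_le_pow₀ hT.one_le
  rw [← hT5]
  refine maxAbs_le (zero_le_one.trans hT5_one) (Fin.lastCases ?_ fun i => ?_)
  · simpa using hT5_one
  · rw [Fin.snoc_castSucc]
    exact (apply_le_maxAbs b i).trans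
      (hT.maxAbs_le_of_forall_inter_nonempty hd hb hZ hmeets)

theorem maxAbs_snoc_le_of_isPCF_of_extends {K : Type*} [CommRing K] [Algebra K L]
    {v : AbsoluteValue K ℝ} (hwv : ∀ x, w (algebraMap K L x) = v x)
    (hκ : SumBound w (N + 1).factorial κ) (hd : 2 ≤ d)
    {A : SpecialLinearGroup (Fin N) K} {b : Fin N → K}
    (h : (powerAffineEndo (Nat.ne_zero_of_lt hd) (A.map (algebraMap K L))
      (algebraMap K L ∘ b)).IsPCF) :
    maxAbs v (Fin.snoc b 1 : Fin (N + 1) → K) ≤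
      κ ^ (5 * (N + 3)) * maxAbs v (fun p : Fin N × Fin N => A.1 p.1 p.2) ^ (5 * N) := by
  have hcomp {ι : Type} (x : ι → K) : maxAbs w (algebraMap K L ∘ x) = maxAbs v x :=
    iSup_congr fun i => hwv (x i)
  have hsnoc : (Fin.snoc (algebraMap K L ∘ b) 1 : Fin (N + 1) → L) =
      algebraMap K L ∘ (Fin.snoc b 1 : Fin (N + 1) → K) := by
    rw [Fin.comp_snoc, map_one]
  rw [← hcomp, ← hcomp, ← hsnoc]
  exact h.maxAbs_snoc_le hκ hd

end LocalBound

section GlobalBound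

open Height Height.AdmissibleAbsValues Module NumberField

variable {K Ω : Type*} [Field K] [NumberField K] [Field Ω] [Algebra K Ω]
  [Algebra.IsAlgebraic K Ω] {v : AbsoluteValue K ℝ}

theorem exists_absoluteValue_extending_of_mem_archAbsVal (hv : v ∈ archAbsVal (K := K)) :
    ∃ w : AbsoluteValue Ω ℝ, ∀ x, w (algebraMap K Ω x) = v x := by
  obtain ⟨v, rfl⟩ := isInfinitePlace_iff v |>.1 (mem_multisetInfinitePlace.1 hv)
  obtain ⟨w, rfl⟩ := InfinitePlace.comap_surjective (K := Ω) v
  exact ⟨w.1, fun _ => rfl⟩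

theorem exists_isNonarchimedean_absoluteValue_extending_of_mem_nonarchAbsVal
    (hv : v ∈ nonarchAbsVal (K := K)) :
    ∃ w : AbsoluteValue Ω ℝ, IsNonarchimedean w ∧ ∀ x, w (algebraMap K Ω x) = v x := by
  obtain ⟨v, rfl⟩ := (isFinitePlace_iff v).1 hv
  exact exists_isNonarchimedean_absoluteValue_extending_finitePlace v Ω

theorem logHeight_snoc_le_of_isPCF [IsAlgClosed Ω] {N d : ℕ} [NeZero N] (hd : 2 ≤ d)
    {A : SpecialLinearGroup (Fin N) K} {b : Fin N → K}
    (h : (powerAffineEndo (Nat.ne_zero_of_lt hd) (A.map (algebraMap K Ω))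
      (algebraMap K Ω ∘ b)).IsPCF) :
    logHeight (Fin.snoc b 1 : Fin (N + 1) → K) ≤
      finrank ℚ K * (5 * (N + 3) * Real.log (N + 1).factorial) +
        5 * N * logHeight fun p : Fin N × Fin N => A.1 p.1 p.2 := by
  have : CharZero Ω := charZero_of_injective_algebraMap (algebraMap K Ω).injective
  have : NeZero (d : Ω) := ⟨Nat.cast_ne_zero.2 (by omega)⟩
  have hb : (Fin.snoc b 1 : Fin (N + 1) → K) ≠ 0 := fun h => by
    simpa using congrFun h (Fin.last N)
  have hA : (fun p : Fin N × Fin N => A.1 p.1 p.2) ≠ 0 := fun h =>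
    A.row_ne_zero 0 (_root_.funext fun j => congrFun h (0, j))
  have hmul : mulHeight (Fin.snoc b 1 : Fin (N + 1) → K) ≤
      (((N + 1).factorial : ℝ) ^ (5 * (N + 3))) ^ finrank ℚ K *
        mulHeight (fun p : Fin N × Fin N => A.1 p.1 p.2) ^ (5 * N) := by
    rw [← totalWeight_eq_finrank]
    refine mulHeight_le_of_forall_maxAbs_le hb hA (by positivity) (fun v hv => ?_) fun v hv => ?_
    · obtain ⟨w, hwv⟩ := exists_absoluteValue_extending_of_mem_archAbsVal (Ω := Ω) hv
      exact maxAbs_snoc_le_of_isPCF_of_extends hwv .natCast hd h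
    · obtain ⟨w, hw, hwv⟩ :=
        exists_isNonarchimedean_absoluteValue_extending_of_mem_nonarchAbsVal (Ω := Ω) hv
      simpa using maxAbs_snoc_le_of_isPCF_of_extends hwv (.one_of_isNonarchimedean hw) hd h
  calc logHeight (Fin.snoc b 1 : Fin (N + 1) → K)
      ≤ Real.log ((((N + 1).factorial : ℝ) ^ (5 * (N + 3))) ^ finrank ℚ K *
          mulHeight (fun p : Fin N × Fin N => A.1 p.1 p.2) ^ (5 * N)) :=
        Real.log_le_log (mulHeight_pos _) hmul
    _ = finrank ℚ K * (5 * (N + 3) * Real.log (N + 1).factorial) +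
          5 * N * logHeight fun p : Fin N × Fin N => A.1 p.1 p.2 := by
      rw [Real.log_mul (by positivity) (pow_pos (mulHeight_pos _) _).ne', Real.log_pow,
        Real.log_pow, Real.log_pow, logHeight_eq_log_mulHeight]
      push_cast
      ring

theorem exists_numberField_map_eq {N : ℕ} (A : SpecialLinearGroup (Fin N) (AlgebraicClosure ℚ))
    (b : Fin N → AlgebraicClosure ℚ) :
    ∃ (K : IntermediateField ℚ (AlgebraicClosure ℚ)) (_ : NumberField K)
      (A' : SpecialLinearGroup (Fin N) K) (b' : Fin N → K),
      A'.map (algebraMap K (AlgebraicClosure ℚ)) = A ∧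
        algebraMap K (AlgebraicClosure ℚ) ∘ b' = b := by
  let S : Set (AlgebraicClosure ℚ) :=
    Set.range (fun p : Fin N × Fin N => A.1 p.1 p.2) ∪ Set.range b
  let K := IntermediateField.adjoin ℚ S
  let A' : Matrix (Fin N) (Fin N) K := of fun i j =>
    ⟨A.1 i j, IntermediateField.subset_adjoin ℚ S (.inl ⟨(i, j), rfl⟩)⟩
  let b' : Fin N → K := fun i => ⟨b i, IntermediateField.subset_adjoin ℚ S (.inr ⟨i, rfl⟩)⟩
  have hA' : (algebraMap K (AlgebraicClosure ℚ)).mapMatrix A' = A.1 := rfl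
  have hdet : A'.det = 1 := (algebraMap K (AlgebraicClosure ℚ)).injective <| by
    rw [RingHom.map_det, hA', A.2, map_one]
  exact ⟨K, numberField_adjoin_of_finite ((Set.finite_range _).union (Set.finite_range _)),
    ⟨A', hdet⟩, b', Subtype.ext hA', rfl⟩

theorem mainTheorem5_general {N d : ℕ} (hd : 2 ≤ d)
    {A : SpecialLinearGroup (Fin N) (AlgebraicClosure ℚ)} {b : Fin N → AlgebraicClosure ℚ}
    (h : (powerAffineEndo (Nat.ne_zero_of_lt hd) A b).IsPCF) :
    affineHeight b ≤ 5 * (N + 3) * Real.log (N + 1).factorial + 5 * N * matrixHeight A.1 := by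
  obtain rfl | hN := eq_or_ne N 0
  · have : Subsingleton (Fin (0 + 1)) := inferInstanceAs (Subsingleton (Fin 1))
    exact (absLogHeight_eq_zero_of_subsingleton _).trans_le (by simp)
  have : NeZero N := ⟨hN⟩
  obtain ⟨K, _, A, b, rfl, rfl⟩ := exists_numberField_map_eq A b
  have : Algebra.IsAlgebraic ℚ (AlgebraicClosure ℚ) := AlgebraicClosure.isAlgebraic ℚ
  have : Algebra.IsAlgebraic K (AlgebraicClosure ℚ) := .tower_top (K := ℚ) K
  have hA : matrixHeight (A.map (algebraMap K (AlgebraicClosure ℚ))).1 =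
      logHeight (fun p : Fin N × Fin N => A.1 p.1 p.2) / finrank ℚ K :=
    absLogHeight_coe K _
  have hb : affineHeight (algebraMap K (AlgebraicClosure ℚ) ∘ b) =
      logHeight (Fin.snoc b 1 : Fin (N + 1) → K) / finrank ℚ K := by
    rw [← absLogHeight_coe, affineHeight]
    exact congrArg absLogHeight (Fin.comp_snoc (algebraMap K (AlgebraicClosure ℚ)) b 1).symm
  have hK : (0 : ℝ) < finrank ℚ K := Nat.cast_pos.2 finrank_pos
  rw [hA, hb, div_le_iff₀ hK, add_mul, mul_assoc (5 * (N : ℝ)),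
    div_mul_cancel₀ _ hK.ne', mul_comm _ (finrank ℚ K : ℝ)]
  exact logHeight_snoc_le_of_isPCF hd h

end GlobalBound

theorem mainTheorem5 (N d : ℕ) (hd : 2 ≤ d) (B : ℝ) (hB : 0 ≤ B) :
    ∃ C : ℝ, ∀ A : Matrix.SpecialLinearGroup (Fin N) (AlgebraicClosure ℚ),
      matrixHeight A.1 ≤ B → ∀ b : Fin N → AlgebraicClosure ℚ,
        (powerAffineEndo (show d ≠ 0 by omega) A b).IsPCF → affineHeight b ≤ C :=
  ⟨5 * (N + 3) * Real.log (N + 1).factorial + 5 * N * B, fun _ hA _ h =>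
    (mainTheorem5_general hd h).trans (by gcongr)⟩
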